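/- A planar doodle diagram is a connected $4$-valent graph $D$ (loops and multiple edges allowed, with at least one vertex) cellularly embedded in the sphere $S^2$, considered up to homeomorphism, i.e. given by its edges and the cyclic order of the half-edges at each vertex, subject to $V-E+F=2$. Its vertices are called crossings and the components of $S^2\setminus D$ are called regions; the number of edges of a region is the number of edges in its boundary curve. The diagram is minimal if no region has exactly one edge or exactly two edges (no monogons, no bigons). It is prime if its graph is $3$-connected, i.e. it has more than $3$ vertices and is not disconnected by the removal of fewer than $3$ vertices. **Lemma 6.7.** Let $D$ be a minimal prime planar doodle diagram with $n$ crossings. Then every region of $D$ has fewer than $(n+1)/2$ edges. -/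

import Mathlib

/-- A finite cellular 4-valent graph on a closed oriented surface, recorded by its rotation system.
`D` is the set of darts (half-edges, i.e. edges with a chosen direction, based at their tail):
`edge` sends a dart to the other half of its edge, and `rot` sends a dart to the next one,
anticlockwise, based at the same crossing. Every cycle of `rot` has length exactly four. Loops and
multiple edges are allowed. -/
structure FourValentMap (D : Type*) where
  edge : Equiv.Perm D
  rot : Equiv.Perm D
  edge_edge : ∀ d, edge (edge d) = d
  edge_ne : ∀ d, edge d ≠ d
  rot_four : ∀ d, (rot ^ 4) d = d
  rot_two_ne : ∀ d, (rot ^ 2) d ≠ d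

namespace FourValentMap

variable {D : Type*} (X : FourValentMap D)

/-- The permutation tracing the boundary curves of the regions: run along a dart to the crossing at
its head, and leave that crossing by the neighbouring dart. -/
def face : Equiv.Perm D := X.rot * X.edge

/-- The crossings (vertices) are the cycles of `rot`. -/
abbrev Crossing : Type _ := Quotient (Equiv.Perm.SameCycle.setoid X.rot)

/-- The edges are the cycles of `edge`, i.e. the pairs of opposite darts. -/
abbrev Edge : Type _ := Quotient (Equiv.Perm.SameCycle.setoid X.edge)

/-- The regions (2-cells) are the cycles of `face`. -/
abbrev Region : Type _ := Quotient (Equiv.Perm.SameCycle.setoid X.face)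

/-- The crossing at which a dart is based. -/
def crossingOf (d : D) : X.Crossing := Quotient.mk _ d

/-- The region whose boundary curve runs along a given dart. -/
def regionOf (d : D) : X.Region := Quotient.mk _ d

/-- The number of edges in the boundary curve of a region (an edge having the region on both of its
sides is run along twice, and counted twice). A region `r` is an `i`-gon if `X.size r = i`. -/
noncomputable def size (r : X.Region) : ℕ := Nat.card {d : D // X.regionOf d = r}

/-- The 1-skeleton, as a simple graph on the crossings: two distinct crossings are adjacent if they
are joined by an edge. (Loops and multiplicities play no role in vertex connectivity.) -/
def skeleton : SimpleGraph X.Crossing where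
  Adj u v := u ≠ v ∧ ∃ d : D, X.crossingOf d = u ∧ X.crossingOf (X.edge d) = v
  symm := ⟨by
    rintro u v ⟨huv, d, hu, hv⟩
    exact ⟨huv.symm, X.edge d, hv, by rw [X.edge_edge, hu]⟩⟩
  loopless := ⟨fun _ h => h.1 rfl⟩

end FourValentMap

/-- A graph is `k`-connected if it has more than `k` vertices and is not disconnected whenever fewer
than `k` vertices are removed. -/
def SimpleGraph.IsKConnected {V : Type*} (G : SimpleGraph V) (k : ℕ) : Prop :=
  (k : ℕ∞) < ENat.card V ∧ ∀ S : Finset V, S.card < k → (G.induce {v | v ∉ S}).Connected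

/-- A (connected, non-trivial, planar) doodle diagram: a connected 4-valent graph, with at least one
crossing, cellularly embedded in the sphere. Connectedness says that any two darts are related by
the group generated by `edge` and `rot`; the underlying closed surface is the sphere exactly when
its Euler characteristic is `2`. -/
structure DoodleDiagram (D : Type*) extends FourValentMap D where
  connected : ∀ d d' : D, ∃ g ∈ Subgroup.closure {edge, rot}, g d = d'
  spherical : (Nat.card toFourValentMap.Crossing : ℤ) - Nat.card toFourValentMap.Edge
    + Nat.card toFourValentMap.Region = 2

namespace DoodleDiagram

variable {D : Type*} (X : DoodleDiagram D)

/-- The number of crossings. -/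
noncomputable def crossingNumber : ℕ := Nat.card X.Crossing

/-- A diagram (connected by definition here) is minimal if it has no monogon and no bigon. -/
def IsMinimal : Prop := ∀ r : X.Region, X.size r ≠ 1 ∧ X.size r ≠ 2

/-- A diagram is prime if it is 3-connected. -/
def IsPrime : Prop := X.skeleton.IsKConnected 3

end DoodleDiagram

/-!
Across each corner of a region `r` lies an opposite region, of the same colour as `r` in the
checkerboard colouring. If it were `r` itself, or if it were opposite to `r` at two corners, then
one or two chords through crossings would form a closed curve on the sphere which meets the graph in
at most two crossings. By 3-connectedness all other crossings lie on one side of this curve, and on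
the other side there is a region with at most two edges, against minimality. So `r` has as many
distinct opposite regions as edges, each of them with at least three edges. Together with `r` they
use at most half of the `4n` half-edges, whence `4 * X.size r ≤ 2n`.
-/

theorem apply_eq_of_mem_closure {α β : Type*} {S : Set (Equiv.Perm α)} {s : α → β}
    (hs : ∀ f ∈ S, ∀ x, s (f x) = s x) {g : Equiv.Perm α} (hg : g ∈ Subgroup.closure S) (x : α) :
    s (g x) = s x := by
  induction hg using Subgroup.closure_induction generalizing x with
  | mem f hf => exact hs f hf x
  | one => rfl
  | mul f g _ _ hf hg => rw [Equiv.Perm.mul_apply, hf, hg]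
  | inv f _ hf => rw [← hf (f⁻¹ x)]; exact congrArg s (f.apply_symm_apply x)

theorem apply_eq_of_sameCycle {α β : Type*} {f : Equiv.Perm α} {s : α → β}
    (hs : ∀ x, s (f x) = s x) {x y : α} (h : f.SameCycle x y) : s x = s y := by
  obtain ⟨i, rfl⟩ := h
  have hf : f ^ i ∈ Subgroup.closure {f} :=
    Subgroup.zpow_mem _ (Subgroup.mem_closure_singleton_self f) i
  exact (apply_eq_of_mem_closure (by simpa using hs) hf x).symm

/-- The set of cycles of a permutation, fixed points included. -/
abbrev Cycles {α : Type*} (f : Equiv.Perm α) : Type _ :=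
  Quotient (Equiv.Perm.SameCycle.setoid f)

theorem card_eq_mul_card_cycles {α : Type*} [Finite α] {f : Equiv.Perm α} {m : ℕ}
    (hf : ∀ x, Function.minimalPeriod f x = m) : Nat.card α = m * Nat.card (Cycles f) := by
  classical
  cases nonempty_fintype α
  have hfiber (q : Cycles f) : Nat.card {x // Quotient.mk _ x = q} = m := by
    induction q using Quotient.inductionOn with | h x => ?_
    have horbit : {y | Quotient.mk (Equiv.Perm.SameCycle.setoid f) y = Quotient.mk _ x} =
        MulAction.orbit (Subgroup.zpowers f) x := by
      ext y
      simp only [Set.mem_ofPred_eq, Quotient.eq, MulAction.mem_orbit_iff, Subgroup.exists_zpowers]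
      exact Equiv.Perm.sameCycle_comm
    rw [← hf x, ← Set.coe_ofPred, horbit, Nat.card_eq_fintype_card]
    exact (MulAction.minimalPeriod_eq_card f x).symm
  rw [Nat.card_congr (Equiv.sigmaFiberEquiv (Quotient.mk _ : α → Cycles f)).symm, Nat.card_sigma]
  rw [Finset.sum_congr rfl fun q _ => hfiber q]
  simp [mul_comm]

open Module Matrix

theorem finrank_le_finrank_range_add {K U V W : Type*} [DivisionRing K] [AddCommGroup U]
    [Module K U] [AddCommGroup V] [Module K V] [FiniteDimensional K V] [AddCommGroup W]
    [Module K W] [FiniteDimensional K W] {f : U →ₗ[K] V} {g : U →ₗ[K] W}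
    (h : ∀ x, f x = 0 → g x = 0 → x = 0) :
    finrank K U ≤ finrank K (LinearMap.range f) + finrank K W := by
  rw [← finrank_prod]
  refine LinearMap.finrank_le_finrank_of_injective (f := f.rangeRestrict.prod g)
    ((injective_iff_map_eq_zero _).2 fun x hx => ?_)
  rw [LinearMap.prod_apply, Prod.ext_iff] at hx
  exact h x (congrArg Subtype.val hx.1) hx.2

theorem indicator_dotProduct {K D : Type*} [NonAssocSemiring K] [Fintype D] (C : Finset D)
    (a : D → K) : (C : Set D).indicator 1 ⬝ᵥ a = ∑ d ∈ C, a d := by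
  classical
  simp [dotProduct, Set.indicator_apply]

theorem mem_of_forall_dotProduct_eq_zero {K ι : Type*} [Field K] [Fintype ι]
    {U W : Submodule K (ι → K)} (hUW : ∀ u ∈ U, ∀ w ∈ W, u ⬝ᵥ w = 0)
    (hfinrank : Fintype.card ι ≤ finrank K U + finrank K W) {x : ι → K}
    (hx : ∀ w ∈ W, x ⬝ᵥ w = 0) : x ∈ U := by
  let B : LinearMap.BilinForm K (ι → K) := dotProductBilin K K
  have hB : B.Nondegenerate := by
    refine ⟨fun u hu => dotProduct_eq_zero _ hu, fun u hu => dotProduct_eq_zero _ fun v => ?_⟩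
    rw [dotProduct_comm]; exact hu v
  have horth : U = B.orthogonal W := by
    refine Submodule.eq_of_le_of_finrank_le
      (fun u hu w hw => (dotProduct_comm w u).trans (hUW u hu w hw)) ?_
    rw [LinearMap.BilinForm.finrank_orthogonal hB, finrank_fintype_fun_eq_card]
    omega
  rw [horth]
  exact fun w hw => (dotProduct_comm w x).trans (hx w hw)

/-- The `K`-valued functions that are constant on the cycles of a permutation. -/
def invariantFunctions (K : Type*) [Semiring K] {D : Type*} (f : Equiv.Perm D) :
    Submodule K (D → K) where
  carrier := {a | ∀ d, a (f d) = a d}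
  add_mem' ha hb d := congrArg₂ (· + ·) (ha d) (hb d)
  zero_mem' _ := rfl
  smul_mem' k _ ha d := congrArg (k * ·) (ha d)

theorem finrank_invariantFunctions (K : Type*) [Semiring K] [StrongRankCondition K] {D : Type*}
    [Finite D] (f : Equiv.Perm D) : finrank K (invariantFunctions K f) = Nat.card (Cycles f) := by
  classical
  cases nonempty_fintype D
  let pullback : (Cycles f → K) →ₗ[K] (D → K) := LinearMap.funLeft K K (Quotient.mk _)
  have hrange : LinearMap.range pullback = invariantFunctions K f := by
    refine le_antisymm ?_ fun a ha =>
      ⟨Quotient.lift a fun _ _ h => apply_eq_of_sameCycle ha h, rfl⟩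
    rintro _ ⟨a, rfl⟩ d
    exact congrArg a (Quotient.sound (Equiv.Perm.sameCycle_apply_left.2 (.refl f d)))
  rw [← hrange, LinearMap.finrank_range_of_inj
    (LinearMap.funLeft_injective_of_surjective K K _ Quotient.mk_surjective),
    finrank_fintype_fun_eq_card, Nat.card_eq_fintype_card]

theorem comp_sub_dotProduct_eq_zero {K D : Type*} [CommRing K] [Fintype D] {f : Equiv.Perm D}
    (s : D → K) {a : D → K} (ha : a ∈ invariantFunctions K f) : (s ∘ f - s) ⬝ᵥ a = 0 := by
  have haf : a ∘ f = a := funext ha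
  rw [sub_dotProduct, sub_eq_zero]
  conv_lhs => rw [← haf]
  exact comp_equiv_dotProduct_comp_equiv s a f

/-- A hypermap of genus zero: a pair of permutations generating a transitive group, whose cycles
are the hyperedges and the vertices, while those of the product are the faces. -/
structure IsPlanarHypermap {D : Type*} (α β : Equiv.Perm D) : Prop where
  transitive : ∀ d d', ∃ g ∈ Subgroup.closure {α, β}, g d = d'
  euler : Nat.card (Cycles α) + Nat.card (Cycles β) + Nat.card (Cycles (β * α)) = Nat.card D + 2

namespace IsPlanarHypermap

variable {K D : Type*} {α β : Equiv.Perm D}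

theorem apply_eq {γ : Type*} (h : IsPlanarHypermap α β) {s : D → γ} (hα : ∀ d, s (α d) = s d)
    (hβ : ∀ d, s (β d) = s d) (d d' : D) : s d = s d' := by
  obtain ⟨g, hg, rfl⟩ := h.transitive d d'
  refine (apply_eq_of_mem_closure ?_ hg d).symm
  rintro f (rfl | rfl)
  exacts [hα, hβ]

theorem nonempty (h : IsPlanarHypermap α β) : Nonempty D := by
  by_contra hD
  rw [not_nonempty_iff] at hD
  simpa using h.euler

/-- The coboundary of the cell complex with the elements of `D` as vertices, with an edge from `d`
to `α d` (left summand) and to `β d` (right summand) for each `d`, and with one 2-cell for each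
cycle of `α`, of `β` and of `β * α`. -/
def coboundary (K : Type*) [CommRing K] (α β : Equiv.Perm D) : (D → K) →ₗ[K] (D ⊕ D → K) where
  toFun s := Sum.elim (s ∘ α - s) (s ∘ β - s)
  map_add' s t := by ext (d | d) <;> simp [add_sub_add_comm]
  map_smul' k s := by ext (d | d) <;> simp [mul_sub]

/-- The boundary of the same complex, from 2-chains to 1-chains. -/
def boundary (K : Type*) [CommRing K] (α β : Equiv.Perm D) :
    (invariantFunctions K α × invariantFunctions K β × invariantFunctions K (β * α)) →ₗ[K]
      (D ⊕ D → K) where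
  toFun p := Sum.elim (p.1.1 + p.2.2.1) (p.2.1.1 + p.2.2.1 ∘ α.symm)
  map_add' p q := by ext (d | d) <;> simp [add_add_add_comm]
  map_smul' k p := by ext (d | d) <;> simp [mul_add]

theorem dotProduct_boundary [CommRing K] [Fintype D] (φ ψ : D → K)
    (p : invariantFunctions K α × invariantFunctions K β × invariantFunctions K (β * α)) :
    Sum.elim φ ψ ⬝ᵥ boundary K α β p =
      φ ⬝ᵥ p.1.1 + ψ ⬝ᵥ p.2.1.1 + (φ + ψ ∘ α) ⬝ᵥ p.2.2.1 := by
  change Sum.elim φ ψ ⬝ᵥ Sum.elim _ _ = _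
  rw [sumElim_dotProduct_sumElim, dotProduct_add, dotProduct_add, dotProduct_comp_equiv_symm,
    add_dotProduct]
  ring

theorem coboundary_dotProduct_boundary [CommRing K] [Fintype D] (s : D → K)
    (p : invariantFunctions K α × invariantFunctions K β × invariantFunctions K (β * α)) :
    coboundary K α β s ⬝ᵥ boundary K α β p = 0 := by
  have hface : (s ∘ α - s) + (s ∘ β - s) ∘ α = s ∘ (β * α : Equiv.Perm D) - s := by
    ext d
    simp
  change Sum.elim _ _ ⬝ᵥ _ = 0
  rw [dotProduct_boundary, hface, comp_sub_dotProduct_eq_zero s p.1.2,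
    comp_sub_dotProduct_eq_zero s p.2.1.2, comp_sub_dotProduct_eq_zero s p.2.2.2, add_zero,
    add_zero]

theorem card_le_finrank_range_coboundary [Field K] [Finite D] (h : IsPlanarHypermap α β) :
    Nat.card D ≤ finrank K (LinearMap.range (coboundary K α β)) + 1 := by
  cases nonempty_fintype D
  obtain ⟨d₀⟩ := h.nonempty
  have := finrank_le_finrank_range_add (f := coboundary K α β)
    (g := (LinearMap.proj d₀ : (D → K) →ₗ[K] K)) fun s hs hs₀ => funext fun d =>
      (h.apply_eq (fun d => sub_eq_zero.1 (congrFun hs (.inl d)))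
        (fun d => sub_eq_zero.1 (congrFun hs (.inr d))) d d₀).trans hs₀
  simpa using this

theorem card_add_one_le_finrank_range_boundary [Field K] [Finite D] (h : IsPlanarHypermap α β) :
    Nat.card D + 1 ≤ finrank K (LinearMap.range (boundary K α β)) := by
  cases nonempty_fintype D
  obtain ⟨d₀⟩ := h.nonempty
  have hle := finrank_le_finrank_range_add (f := boundary K α β)
    (g := LinearMap.proj d₀ ∘ₗ (invariantFunctions K (β * α)).subtype ∘ₗ LinearMap.snd K _ _ ∘ₗ
      LinearMap.snd K _ _) ?_
  · have := h.euler
    simp only [finrank_prod, finrank_invariantFunctions, finrank_self] at hle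
    omega
  rintro ⟨⟨a, ha⟩, ⟨b, hb⟩, ⟨c, hc⟩⟩ hp hc₀
  have hac (d : D) : a d = -c d := eq_neg_of_add_eq_zero_left (congrFun hp (.inl d))
  have hbc (d : D) : b d = -c (α.symm d) := eq_neg_of_add_eq_zero_left (congrFun hp (.inr d))
  have hcα (d : D) : c (α d) = c d := by rw [← neg_inj, ← hac, ha, hac]
  have hcβ (d : D) : c (β d) = c d := by
    obtain ⟨d, rfl⟩ := α.surjective d
    rw [hcα]
    exact hc d
  have hc0 : c = 0 := funext fun d => (h.apply_eq hcα hcβ d d₀).trans hc₀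
  have ha0 : a = 0 := funext fun d => by simp [hac, hc0]
  have hb0 : b = 0 := funext fun d => by simp [hbc, hc0]
  simp [ha0, hb0, hc0]

/-- The vanishing of the first cohomology of the sphere. -/
theorem exists_potential [Field K] [Fintype D] (h : IsPlanarHypermap α β) {φ ψ : D → K}
    (hα : ∀ a ∈ invariantFunctions K α, φ ⬝ᵥ a = 0)
    (hβ : ∀ b ∈ invariantFunctions K β, ψ ⬝ᵥ b = 0)
    (hface : ∀ c ∈ invariantFunctions K (β * α), (φ + ψ ∘ α) ⬝ᵥ c = 0) :
    ∃ s : D → K, (∀ d, s (α d) = s d + φ d) ∧ ∀ d, s (β d) = s d + ψ d := by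
  have hmem : Sum.elim φ ψ ∈ LinearMap.range (coboundary K α β) := by
    refine mem_of_forall_dotProduct_eq_zero (W := LinearMap.range (boundary K α β)) ?_ ?_ ?_
    · rintro _ ⟨s, rfl⟩ _ ⟨p, rfl⟩
      exact coboundary_dotProduct_boundary s p
    · have hδ := h.card_le_finrank_range_coboundary (K := K)
      have hd := h.card_add_one_le_finrank_range_boundary (K := K)
      rw [Nat.card_eq_fintype_card] at hδ hd
      rw [Fintype.card_sum]
      omega
    · rintro _ ⟨p, rfl⟩
      rw [dotProduct_boundary, hα _ p.1.2, hβ _ p.2.1.2, hface _ p.2.2.2, add_zero, add_zero]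
  obtain ⟨s, hs⟩ := hmem
  exact ⟨s, fun d => eq_add_of_sub_eq' (congrFun hs (.inl d)),
    fun d => eq_add_of_sub_eq' (congrFun hs (.inr d))⟩

end IsPlanarHypermap

namespace FourValentMap

variable {D : Type*} (X : FourValentMap D)

theorem rot_rot_rot_rot (d : D) : X.rot (X.rot (X.rot (X.rot d))) = d := X.rot_four d

theorem rot_rot_ne (d : D) : X.rot (X.rot d) ≠ d := X.rot_two_ne d

theorem rot_ne (d : D) : X.rot d ≠ d := fun h => X.rot_rot_ne d (by rw [h, h])

theorem rot_rot_rot_ne (d : D) : X.rot (X.rot (X.rot d)) ≠ d := fun h =>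
  X.rot_ne d (by rw [← h, X.rot_rot_rot_rot, h])

theorem minimalPeriod_edge (d : D) : Function.minimalPeriod X.edge d = 2 :=
  Function.minimalPeriod_eq_prime (X.edge_edge d) (X.edge_ne d)

theorem minimalPeriod_rot (d : D) : Function.minimalPeriod X.rot d = 4 :=
  Function.minimalPeriod_eq_prime_pow (p := 2) (k := 1) (X.rot_two_ne d) (X.rot_four d)

theorem crossingOf_rot (d : D) : X.crossingOf (X.rot d) = X.crossingOf d :=
  Quotient.sound (Equiv.Perm.sameCycle_apply_left.2 (.refl X.rot d))

theorem eq_of_crossingOf_eq {x y : D} (h : X.crossingOf y = X.crossingOf x) :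
    y = x ∨ y = X.rot x ∨ y = X.rot (X.rot x) ∨ y = X.rot (X.rot (X.rot x)) := by
  let orbit (d : D) : Prop :=
    d = x ∨ d = X.rot x ∨ d = X.rot (X.rot x) ∨ d = X.rot (X.rot (X.rot x))
  have hinv (d : D) : orbit (X.rot d) = orbit d := by
    have hx : X.rot d = x ↔ d = X.rot (X.rot (X.rot x)) := by
      rw [← X.rot.apply_eq_iff_eq (y := X.rot (X.rot (X.rot x))), X.rot_rot_rot_rot]
    simp only [orbit, hx, X.rot.apply_eq_iff_eq, eq_iff_iff]
    tauto
  exact (apply_eq_of_sameCycle hinv (Quotient.exact h)).mpr (Or.inl rfl)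

theorem size_eq_card_filter [Fintype D] [DecidableEq X.Region] (r : X.Region) :
    X.size r = ({d | X.regionOf d = r} : Finset D).card := by
  rw [size, Nat.card_eq_fintype_card, Fintype.card_subtype]

theorem size_pos [Finite D] (r : X.Region) : 0 < X.size r := by
  induction r using Quotient.inductionOn with | h d => ?_
  have : Nonempty {x : D // X.regionOf x = Quotient.mk _ d} := ⟨⟨d, rfl⟩⟩
  exact Nat.card_pos

theorem size_regionOf_le_card [DecidableEq D] {G : Finset D} (hG : G ⊆ G.image X.face) {x : D}
    (hx : x ∈ G) : X.size (X.regionOf x) ≤ G.card := by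
  have himage : G = G.image X.face := Finset.eq_of_subset_of_card_le hG Finset.card_image_le
  have hinv (d : D) : (X.face d ∈ G) = (d ∈ G) := by
    conv_lhs => rw [himage, X.face.injective.mem_finset_image]
  have hsub : {d | X.regionOf d = X.regionOf x} ⊆ (G : Set D) := fun d hd =>
    (apply_eq_of_sameCycle hinv (Quotient.exact hd)).mpr hx
  exact (Set.ncard_le_ncard hsub).trans_eq (Set.ncard_coe_finset G)

theorem exists_eq_of_connected {β : Type*} {S : Finset X.Crossing}
    (hS : (X.skeleton.induce {v | v ∉ S}).Connected) {s : D → β}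
    (hedge : ∀ d, s (X.edge d) = s d) (hrot : ∀ d, X.crossingOf d ∉ S → s (X.rot d) = s d) :
    ∃ t, ∀ d, X.crossingOf d ∉ S → s d = t := by
  have hcrossing {x y : D} (hx : X.crossingOf x ∉ S) (h : X.crossingOf y = X.crossingOf x) :
      s y = s x := by
    rcases X.eq_of_crossingOf_eq h with rfl | rfl | rfl | rfl <;>
      simp only [hrot, crossingOf_rot, hx, not_false_eq_true]
  obtain ⟨⟨u, hu⟩⟩ := hS.nonempty
  induction u using Quotient.inductionOn with | h d₀ => ?_
  have hreach (v : {v | v ∉ S})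
      (h : (X.skeleton.induce {v | v ∉ S}).Reachable ⟨X.crossingOf d₀, hu⟩ v) :
      ∀ d, X.crossingOf d = v → s d = s d₀ := by
    rw [SimpleGraph.reachable_iff_reflTransGen] at h
    induction h with
    | refl => exact fun d hd => hcrossing hu hd
    | @tail v w _ hadj ih =>
      intro d hd
      obtain ⟨-, e, he, he'⟩ := hadj
      rw [hcrossing (he'.symm ▸ w.2) (hd.trans he'.symm), hedge, ih e he]
  exact ⟨s d₀, fun d hd => hreach ⟨_, hd⟩ (hS.preconnected _ _) d rfl⟩

/-- A checkerboard colouring of the regions, recorded on darts: the colour of a dart is that of the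
region whose boundary curve runs along it. -/
structure IsCheckerboard (c : D → ZMod 2) : Prop where
  edge : ∀ d, c (X.edge d) = c d + 1
  rot : ∀ d, c (X.rot d) = c d + 1

namespace IsCheckerboard

variable {X} {c : D → ZMod 2} (hc : X.IsCheckerboard c)
include hc

theorem rot_rot (d : D) : c (X.rot (X.rot d)) = c d := by
  rw [hc.rot, hc.rot, CharTwo.add_cancel_right]

theorem eq_of_regionOf_eq {x y : D} (h : X.regionOf x = X.regionOf y) : c x = c y := by
  refine apply_eq_of_sameCycle (f := X.face) (fun d => ?_) (Quotient.exact h)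
  change c (X.rot (X.edge d)) = c d
  rw [hc.rot, hc.edge, CharTwo.add_cancel_right]

theorem two_mul_card_color [Fintype D] (κ : ZMod 2) :
    2 * ({d | c d = κ} : Finset D).card = Nat.card D := by
  classical
  have hswap : ({d | c d = κ} : Finset D).card = ({d | ¬ c d = κ} : Finset D).card := by
    have hflip : ∀ u v : ZMod 2, u + 1 = v ↔ u ≠ v := by decide
    refine Finset.card_equiv X.edge fun d => ?_
    simp [hc.edge, hflip]
  have hsum := Finset.card_filter_add_card_filter_not (s := Finset.univ) fun d => c d = κ
  rw [Nat.card_eq_fintype_card, ← Finset.card_univ]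
  omega

end IsCheckerboard

/-- The region facing the corner of `X.regionOf d` just clockwise of `d`, across the crossing at
which `d` is based. -/
def oppositeRegion (d : D) : X.Region := X.regionOf (X.rot (X.rot d))

/-- The chords joining `X.regionOf d` to `X.oppositeRegion d` through the crossing of `d`, for
`d ∈ C`, form a mod 2 cycle: every region is an end of evenly many of them. This is expressed
dually, by summing an arbitrary function on the regions over the ends of the chords. -/
def IsChordCycle (C : Finset D) : Prop :=
  ∀ b : X.Region → ZMod 2, ∑ d ∈ C, (b (X.regionOf d) + b (X.oppositeRegion d)) = 0

/-- The mod 2 intersection number, at the corner between `e` and `X.rot e`, with the chords which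
for `d ∈ C` join `X.regionOf d` to `X.oppositeRegion d`. Such a chord runs through the corners
between `X.rot⁻¹ d` and `d` and between `X.rot d` and `X.rot (X.rot d)`. -/
noncomputable def chordJump (C : Set D) (e : D) : ZMod 2 :=
  C.indicator 1 (X.rot e) + C.indicator 1 (X.rot (X.rot (X.rot e)))

theorem chordJump_of_crossingOf_notMem {C : Set D} {e : D}
    (he : X.crossingOf e ∉ X.crossingOf '' C) : X.chordJump C e = 0 := by
  have hC {x : D} (hx : X.crossingOf x = X.crossingOf e) : C.indicator (1 : D → ZMod 2) x = 0 :=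
    Set.indicator_of_notMem (fun h => he (hx ▸ Set.mem_image_of_mem _ h)) _
  rw [chordJump, hC (X.crossingOf_rot e), hC (by simp only [crossingOf_rot]), add_zero]

theorem indicator_of_crossingOf_eq [DecidableEq D] {C : Set D} (hC : Set.InjOn X.crossingOf C)
    {d e : D} (hd : d ∈ C) (he : X.crossingOf e = X.crossingOf d) :
    C.indicator (1 : D → ZMod 2) e = if e = d then 1 else 0 := by
  split_ifs with hed
  · rw [hed, Set.indicator_of_mem hd, Pi.one_apply]
  · exact Set.indicator_of_notMem (fun h => hed (hC h hd he)) _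

theorem side_of_chordJump {C : Set D} (hC : Set.InjOn X.crossingOf C) {s : D → ZMod 2}
    (hrot : ∀ e, s (X.rot e) = s e + X.chordJump C e) {d : D} (hd : d ∈ C) :
    s (X.rot d) = s d ∧ s (X.rot (X.rot d)) = s d + 1 ∧
      s (X.rot (X.rot (X.rot d))) = s d + 1 := by
  classical
  have h0 : s (X.rot d) = s d := by
    rw [hrot, chordJump, X.indicator_of_crossingOf_eq hC hd (X.crossingOf_rot d),
      X.indicator_of_crossingOf_eq hC hd (by simp only [crossingOf_rot]), if_neg (X.rot_ne d),
      if_neg (X.rot_rot_rot_ne d), add_zero, add_zero]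
  have h1 : s (X.rot (X.rot d)) = s d + 1 := by
    rw [hrot, h0, chordJump, X.rot_rot_rot_rot,
      X.indicator_of_crossingOf_eq hC hd (by simp only [crossingOf_rot]),
      X.indicator_of_crossingOf_eq hC hd rfl, if_neg (X.rot_rot_ne d), if_pos rfl, zero_add]
  have h2 : s (X.rot (X.rot (X.rot d))) = s d + 1 := by
    rw [hrot, h1, chordJump, X.rot_rot_rot_rot,
      X.indicator_of_crossingOf_eq hC hd (X.crossingOf_rot d),
      X.indicator_of_crossingOf_eq hC hd (by simp only [crossingOf_rot]), if_neg (X.rot_ne d),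
      if_neg (X.rot_rot_rot_ne d), add_zero, add_zero]
  exact ⟨h0, h1, h2⟩

theorem exists_side_of_chordJump {C : Set D} (hC : Set.InjOn X.crossingOf C) {s : D → ZMod 2}
    (hrot : ∀ e, s (X.rot e) = s e + X.chordJump C e) (t : ZMod 2) {d : D} (hd : d ∈ C) :
    ∃ x, (x = d ∨ x = X.rot (X.rot d)) ∧ s x ≠ t ∧
      ∀ e, X.crossingOf e = X.crossingOf d → s e ≠ t → e = x ∨ e = X.rot x := by
  obtain ⟨h1, h2, h3⟩ := X.side_of_chordJump hC hrot hd
  have hflip : ∀ u v : ZMod 2, u + 1 ≠ v ↔ u = v := by decide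
  by_cases ht : s d = t
  · refine ⟨X.rot (X.rot d), Or.inr rfl, by rwa [h2, hflip], fun e he hse => ?_⟩
    rcases X.eq_of_crossingOf_eq he with rfl | rfl | rfl | rfl
    · exact absurd ht hse
    · exact absurd (h1.trans ht) hse
    · exact Or.inl rfl
    · exact Or.inr rfl
  · refine ⟨d, Or.inl rfl, ht, fun e he hse => ?_⟩
    rcases X.eq_of_crossingOf_eq he with rfl | rfl | rfl | rfl
    · exact Or.inl rfl
    · exact Or.inr rfl
    · exact absurd ((hflip _ _).1 (h2 ▸ hse)) ht
    · exact absurd ((hflip _ _).1 (h3 ▸ hse)) ht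

end FourValentMap

namespace DoodleDiagram

variable {D : Type*} (X : DoodleDiagram D)

theorem isPlanarHypermap [Finite D] : IsPlanarHypermap X.edge X.rot where
  transitive := X.connected
  euler := by
    have hspherical := X.spherical
    have hedge := card_eq_mul_card_cycles X.minimalPeriod_edge
    change (Nat.card (Cycles X.rot) : ℤ) - Nat.card (Cycles X.edge)
      + Nat.card (Cycles (X.rot * X.edge)) = 2 at hspherical
    omega

theorem card_dart_eq_four_mul [Finite D] : Nat.card D = 4 * X.crossingNumber :=
  card_eq_mul_card_cycles X.minimalPeriod_rot

theorem exists_isCheckerboard [Finite D] : ∃ c, X.IsCheckerboard c := by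
  cases nonempty_fintype D
  have hedge : ∀ a ∈ invariantFunctions (ZMod 2) X.edge, 1 ⬝ᵥ a = 0 := fun a ha => by
    rw [one_dotProduct]
    exact Finset.sum_ninvolution X.edge (fun d => by rw [ha, CharTwo.add_self_eq_zero])
      (fun d _ => X.edge_ne d) (fun _ => Finset.mem_univ _) X.edge_edge
  have hrot : ∀ b ∈ invariantFunctions (ZMod 2) X.rot, 1 ⬝ᵥ b = 0 := fun b hb => by
    rw [one_dotProduct]
    exact Finset.sum_ninvolution (fun d => X.rot (X.rot d)) (fun d => by
      rw [hb, hb, CharTwo.add_self_eq_zero]) (fun d _ => X.rot_two_ne d)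
      (fun _ => Finset.mem_univ _) X.rot_rot_rot_rot
  have hface : (1 : D → ZMod 2) + (1 : D → ZMod 2) ∘ X.edge = 0 :=
    funext fun _ => CharTwo.add_self_eq_zero 1
  obtain ⟨c, hc⟩ := X.isPlanarHypermap.exists_potential hedge hrot fun c _ => by
    rw [hface, zero_dotProduct]
  exact ⟨c, hc.1, hc.2⟩

theorem chordJump_dotProduct_eq_zero [Fintype D] (C : Set D) {b : D → ZMod 2}
    (hb : b ∈ invariantFunctions (ZMod 2) X.rot) : X.chordJump C ⬝ᵥ b = 0 := by
  have h1 : b ∘ X.rot = b := funext hb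
  have h3 : b ∘ (X.rot ^ 3 : Equiv.Perm D) = b := by
    funext d
    exact ((hb _).trans (hb _)).trans (hb d)
  change (C.indicator 1 ∘ X.rot + C.indicator 1 ∘ (X.rot ^ 3 : Equiv.Perm D)) ⬝ᵥ b = 0
  rw [add_dotProduct]
  conv_lhs =>
    congr
    · rw [← h1, comp_equiv_dotProduct_comp_equiv]
    · rw [← h3, comp_equiv_dotProduct_comp_equiv]
  exact CharTwo.add_self_eq_zero _

theorem chordJump_comp_edge_dotProduct [Fintype D] (C : Finset D) {b : D → ZMod 2}
    (hb : b ∈ invariantFunctions (ZMod 2) X.face) :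
    (X.chordJump C ∘ X.edge) ⬝ᵥ b = ∑ d ∈ C, (b d + b (X.rot (X.rot d))) := by
  have hbf : b ∘ X.face = b := funext hb
  let χ : D → ZMod 2 := (C : Set D).indicator 1
  have hχ : X.chordJump C ∘ X.edge = (χ + χ ∘ (X.rot ^ 2 : Equiv.Perm D)) ∘ X.face := rfl
  have hsymm : b ∘ (X.rot ^ 2 : Equiv.Perm D).symm = b ∘ (X.rot ^ 2 : Equiv.Perm D) :=
    funext fun d => congrArg b <| (Equiv.symm_apply_eq _).2 (X.rot_rot_rot_rot d).symm
  calc (X.chordJump C ∘ X.edge) ⬝ᵥ b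
      = ((χ + χ ∘ (X.rot ^ 2 : Equiv.Perm D)) ∘ X.face) ⬝ᵥ (b ∘ X.face) := by rw [hχ, hbf]
    _ = χ ⬝ᵥ b + χ ⬝ᵥ (b ∘ (X.rot ^ 2 : Equiv.Perm D)) := by
      rw [comp_equiv_dotProduct_comp_equiv, add_dotProduct, ← hsymm, dotProduct_comp_equiv_symm]
    _ = ∑ d ∈ C, (b d + b (X.rot (X.rot d))) := by
      rw [indicator_dotProduct, indicator_dotProduct, ← Finset.sum_add_distrib]
      rfl

/-- A mod 2 cycle separates the sphere, and `s` tells on which side of it an edge lies. -/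
theorem exists_chord_potential [Finite D] {C : Finset D} (hC : X.IsChordCycle C) :
    ∃ s : D → ZMod 2, (∀ d, s (X.edge d) = s d) ∧ ∀ d, s (X.rot d) = s d + X.chordJump C d := by
  cases nonempty_fintype D
  have hface : ∀ b ∈ invariantFunctions (ZMod 2) X.face,
      (0 + X.chordJump C ∘ X.edge) ⬝ᵥ b = 0 := fun b hb => by
    rw [zero_add, X.chordJump_comp_edge_dotProduct C hb]
    exact hC (Quotient.lift b fun _ _ h => apply_eq_of_sameCycle hb h)
  obtain ⟨s, hedge, hrot⟩ := X.isPlanarHypermap.exists_potential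
    (fun _ _ => zero_dotProduct _) (fun _ hb => X.chordJump_dotProduct_eq_zero C hb) hface
  exact ⟨s, fun d => (hedge d).trans (add_zero _), hrot⟩

theorem exists_size_le_card [Finite D] {k : ℕ} (hk : X.skeleton.IsKConnected k) {c : D → ZMod 2}
    (hc : X.IsCheckerboard c) {C : Finset D} (hcard : C.card < k) (hne : C.Nonempty)
    (hinj : Set.InjOn X.crossingOf C) (hcolor : ∀ d ∈ C, ∀ d' ∈ C, c d = c d')
    (hC : X.IsChordCycle C) :
    ∃ r, X.size r ≤ C.card := by
  classical
  obtain ⟨s, hedge, hrot⟩ := X.exists_chord_potential hC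
  obtain ⟨t, ht⟩ := X.exists_eq_of_connected
    (hk.2 (C.image X.crossingOf) (Finset.card_image_le.trans_lt hcard)) hedge fun d hd => by
      rw [hrot, X.chordJump_of_crossingOf_notMem (by simpa using hd), add_zero]
  choose! x hx hxt hside using fun d hd => X.exists_side_of_chordJump hinj hrot t (d := d) hd
  have hxc (d : D) (hd : d ∈ C) : c (x d) = c d := by
    rcases hx d hd with h | h <;> rw [h]
    exact hc.rot_rot d
  have hxx (d : D) (hd : d ∈ C) : ∃ d' ∈ C, X.edge (x d) = X.rot (x d') := by
    have hs : s (X.edge (x d)) ≠ t := by rw [hedge]; exact hxt d hd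
    obtain ⟨d', hd', hcross⟩ := Finset.mem_image.1 (not_not.1 fun h => hs (ht _ h))
    refine ⟨d', hd', (hside d' hd' _ hcross.symm hs).resolve_left fun h => ?_⟩
    have hcc : c d + 1 = c d := by
      rw [← hxc d hd, ← hc.edge, h, hxc d' hd', hxc d hd, hcolor d hd d' hd']
    exact one_ne_zero (add_eq_left.1 hcc)
  -- Only crossings of `C` have edges off the side `t`, so the boundary of a region there never
  -- leaves `G`.
  let G := C.image fun d => X.rot (x d)
  have hG : G ⊆ G.image X.face := by
    intro y hy
    obtain ⟨d, hd, rfl⟩ := Finset.mem_image.1 hy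
    obtain ⟨d', hd', h⟩ := hxx d hd
    refine Finset.mem_image.2 ⟨_, Finset.mem_image_of_mem _ hd', ?_⟩
    change X.rot (X.edge (X.rot (x d'))) = X.rot (x d)
    rw [← h, X.edge_edge]
  obtain ⟨d, hd⟩ := hne
  exact ⟨_, (X.size_regionOf_le_card hG (Finset.mem_image_of_mem _ hd)).trans Finset.card_image_le⟩

section MinimalPrime

variable {X} [Finite D]

theorem IsMinimal.three_le_size (hmin : X.IsMinimal) (r : X.Region) : 3 ≤ X.size r := by
  have := X.size_pos r
  have := hmin r
  omega

theorem oppositeRegion_ne_regionOf (hmin : X.IsMinimal) (hprime : X.IsPrime) (d : D) :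
    X.oppositeRegion d ≠ X.regionOf d := by
  intro h
  obtain ⟨c, hc⟩ := X.exists_isCheckerboard
  obtain ⟨r, hr⟩ := X.exists_size_le_card hprime hc (C := {d}) (by simp) (by simp) (by simp)
    (by simp) fun b => by rw [Finset.sum_singleton, h, CharTwo.add_self_eq_zero]
  have := hmin.three_le_size r
  rw [Finset.card_singleton] at hr
  omega

theorem eq_of_regionOf_eq_of_crossingOf_eq (hmin : X.IsMinimal) (hprime : X.IsPrime) {d d' : D}
    (hr : X.regionOf d' = X.regionOf d) (hv : X.crossingOf d' = X.crossingOf d) : d' = d := by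
  obtain ⟨c, hc⟩ := X.exists_isCheckerboard
  have hcolor : c d' = c d := hc.eq_of_regionOf_eq hr
  rcases X.eq_of_crossingOf_eq hv with rfl | rfl | rfl | rfl
  · rfl
  · rw [hc.rot] at hcolor
    exact absurd (add_eq_left.1 hcolor) one_ne_zero
  · exact absurd hr (oppositeRegion_ne_regionOf hmin hprime d)
  · rw [hc.rot, hc.rot_rot] at hcolor
    exact absurd (add_eq_left.1 hcolor) one_ne_zero

theorem oppositeRegion_injOn (hmin : X.IsMinimal) (hprime : X.IsPrime) (r : X.Region) :
    Set.InjOn X.oppositeRegion {d | X.regionOf d = r} := by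
  classical
  rintro d rfl d' (hr : X.regionOf d' = X.regionOf d) hopp
  by_contra hne
  obtain ⟨c, hc⟩ := X.exists_isCheckerboard
  have hregion : ∀ e ∈ ({d, d'} : Finset D), X.regionOf e = X.regionOf d := by simp [hr]
  have hinj : Set.InjOn X.crossingOf ({d, d'} : Finset D) := fun e he e' he' hv =>
    eq_of_regionOf_eq_of_crossingOf_eq hmin hprime
      ((hregion e he).trans (hregion e' he').symm) hv
  obtain ⟨q, hq⟩ := X.exists_size_le_card hprime hc (C := {d, d'})
    (Finset.card_le_two.trans_lt (by norm_num)) (by simp) hinj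
    (fun e he e' he' => hc.eq_of_regionOf_eq ((hregion e he).trans (hregion e' he').symm))
    fun b => by rw [Finset.sum_pair hne, hr, hopp, CharTwo.add_self_eq_zero]
  have := hmin.three_le_size q
  have := hq.trans Finset.card_le_two
  omega

theorem IsMinimal.three_mul_card_le [Fintype D] [DecidableEq X.Region] (hmin : X.IsMinimal)
    (T : Finset X.Region) : 3 * T.card ≤ ({d | X.regionOf d ∈ T} : Finset D).card := by
  refine Finset.mul_card_image_le_card_of_maps_to (f := X.regionOf) (by simp) 3 fun q hq => ?_
  rw [Finset.filter_filter]
  refine (hmin.three_le_size q).trans_eq ((X.size_eq_card_filter q).trans ?_)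
  congr 1 with d
  simp only [Finset.mem_filter_univ]
  grind

theorem two_mul_size_le_crossingNumber (hmin : X.IsMinimal) (hprime : X.IsPrime)
    (r : X.Region) : 2 * X.size r ≤ X.crossingNumber := by
  classical
  cases nonempty_fintype D
  obtain ⟨c, hc⟩ := X.exists_isCheckerboard
  obtain ⟨d₀, rfl : X.regionOf d₀ = r⟩ := Quotient.exists_rep r
  let inner : Finset D := {d | X.regionOf d = X.regionOf d₀}
  let outer : Finset D := {d | X.regionOf d ∈ inner.image X.oppositeRegion}
  have hinner (d : D) : d ∈ inner ↔ X.regionOf d = X.regionOf d₀ := Finset.mem_filter_univ d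
  have houter (d : D) : d ∈ outer ↔ ∃ e ∈ inner, X.oppositeRegion e = X.regionOf d := by
    simp only [outer, Finset.mem_filter_univ, Finset.mem_image]
  have hsize : X.size (X.regionOf d₀) = inner.card := X.size_eq_card_filter _
  have houter_card : 3 * inner.card ≤ outer.card := by
    have hinj : Set.InjOn X.oppositeRegion inner := fun d hd e he =>
      oppositeRegion_injOn hmin hprime (X.regionOf d₀) ((hinner d).1 hd) ((hinner e).1 he)
    rw [← Finset.card_image_of_injOn hinj]
    exact hmin.three_mul_card_le _
  have hdisj : Disjoint inner outer := Finset.disjoint_left.2 fun d hd hd' => by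
    obtain ⟨e, he, h⟩ := (houter d).1 hd'
    exact oppositeRegion_ne_regionOf hmin hprime e
      (h.trans (((hinner d).1 hd).trans ((hinner e).1 he).symm))
  have hcolor : inner ∪ outer ⊆ ({d | c d = c d₀} : Finset D) := by
    have hcinner (d : D) (hd : d ∈ inner) : c d = c d₀ := hc.eq_of_regionOf_eq ((hinner d).1 hd)
    refine Finset.union_subset (fun d hd => (Finset.mem_filter_univ d).2 (hcinner d hd))
      fun d hd => (Finset.mem_filter_univ d).2 ?_
    obtain ⟨e, he, h⟩ := (houter d).1 hd
    rw [← hc.eq_of_regionOf_eq h, hc.rot_rot, hcinner e he]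
  have hhalf := hc.two_mul_card_color (c d₀)
  have hle := Finset.card_le_card hcolor
  rw [Finset.card_union_of_disjoint hdisj] at hle
  have := X.card_dart_eq_four_mul
  omega

end MinimalPrime

end DoodleDiagram

theorem lemma6p7 {D : Type*} [Finite D] (X : DoodleDiagram D) (hmin : X.IsMinimal)
    (hprime : X.IsPrime) (r : X.Region) :
    (X.size r : ℝ) < ((X.crossingNumber : ℝ) + 1) / 2 := by
  have h : (2 * X.size r : ℝ) ≤ X.crossingNumber := by
    exact_mod_cast DoodleDiagram.two_mul_size_le_crossingNumber hmin hprime r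
  linarith
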